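/- Let $a_0,a_1,\dots,b_0,b_1,\dots$ be mutually independent real random variables on a probability space $(\Omega,\mathscr F,P)$, each normally distributed with mean $0$ and variance $1$, put $\eta_j=a_j+ib_j$, and for $N\ge 1$ let $S_N(z)=\sum_{j=0}^{N}\eta_j z^j$. For $\mathbf K=K_1+iK_2\in\mathbb C$ and a compact set $\Phi\subset\mathbb C$ let $\nu_{N,\mathbf K}(\Phi)$ be the number of (distinct) $z\in\Phi$ with $S_N(z)=\mathbf K$. Then for all $N\ge1$ and $\mathbf K\in\mathbb C$ there is exactly one continuous function $h_{N,\mathbf K}:\mathbb C\to[0,\infty)$, the expected density of the zeros of $S_N(z)=\mathbf K$, such that $$\mathbb E\,\nu_{N,\mathbf K}(\Phi)=\int_\Phi h_{N,\mathbf K}(x+iy)\,dx\,dy\qquad\text{for every compact }\Phi\subset\mathbb C .$$ Write $B(z)=1/(1-|z|^2)$. If $|z|<1$, then for every $\mathbf K\in\mathbb C$ $$\lim_{N\to\infty}h_{N,\mathbf K}(z)=\frac1\pi\,e^{-(K_1^2+K_2^2)/(2B(z))}\,B(z)\left\{B(z)+\frac{K_1^2+K_2^2}{2}\,|z|^2\right\}.$$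 Consequently, for every $K>0$ and every $\mathbf K$ on the circle $K_1^2+K_2^2=2K^2$ (the circle centred at $0$ through $(K,K)$), $$\lim_{N\to\infty}h_{N,\mathbf K}(z)=\frac1\pi\,e^{-K^2/B(z)}\,B(z)\left(B(z)+K^2|z|^2\right),$$ while for every $\mathbf K$ on the circle $K_1^2+K_2^2=K^2$ of radius $K$, $$\lim_{N\to\infty}h_{N,\mathbf K}(z)=\frac1\pi\,e^{-K^2/(2B(z))}\,B(z)\left(B(z)+\frac{K^2}{2}|z|^2\right);$$ and for $\mathbf K=0$, $$\lim_{N\to\infty}h_{N,\mathbf 0}(z)=\frac1\pi\,B(z)^2.$$ -/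

import Mathlib

open MeasureTheory ProbabilityTheory Filter Topology

noncomputable section

namespace RandomSum

variable {Ω : Type*} [MeasurableSpace Ω]

/-- `a₀, a₁, …, b₀, b₁, …` are mutually independent standard real normal variables. -/
structure IsStdGaussianPair (P : Measure Ω) (a b : ℕ → Ω → ℝ) : Prop where
  law_a : ∀ j, HasLaw (a j) (gaussianReal 0 1) P
  law_b : ∀ j, HasLaw (b j) (gaussianReal 0 1) P
  indep : iIndepFun (Sum.elim a b) P

/-- The random sum `S_N(z) = ∑_{j=0}^N η_j f_j(z)` with `η_j = a_j + i b_j`. -/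
def randomSum (a b : ℕ → Ω → ℝ) (f : ℕ → ℂ → ℂ) (N : ℕ) (ω : Ω) (z : ℂ) : ℂ :=
  ∑ j ∈ Finset.range (N + 1), ((a j ω : ℂ) + (b j ω : ℂ) * Complex.I) * f j z

/-- The number `ν_{N,K}(Φ)` of solutions in `Φ` of the random equation `S_N(z) = K`. -/
def zeroCount (a b : ℕ → Ω → ℝ) (f : ℕ → ℂ → ℂ) (N : ℕ) (K : ℂ) (Φ : Set ℂ) (ω : Ω) : ℕ∞ :=
  {z ∈ Φ | randomSum a b f N ω z = K}.encard

/-- `h` is the (nonnegative, continuous) expected density of the zeros of `S_N(z) = K`: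
`E ν_{N,K}(Φ) = ∫_Φ h(z) dz` for every compact `Φ ⊆ ℂ`, with respect to planar Lebesgue measure. -/
structure IsExpectedZeroDensity (P : Measure Ω) (a b : ℕ → Ω → ℝ) (f : ℕ → ℂ → ℂ) (N : ℕ) (K : ℂ)
    (h : ℂ → ℝ) : Prop where
  continuous : Continuous h
  nonneg : ∀ z, 0 ≤ h z
  aemeasurable_count : ∀ Φ : Set ℂ, IsCompact Φ →
    AEMeasurable (fun ω => (zeroCount a b f N K Φ ω : ENNReal)) P
  expectation_eq : ∀ Φ : Set ℂ, IsCompact Φ →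
    ∫⁻ ω, (zeroCount a b f N K Φ ω : ENNReal) ∂P = ∫⁻ z in Φ, ENNReal.ofReal (h z)

/-- `B(z) = 1 / (1 - |z|²)`. -/
def B (z : ℂ) : ℝ := 1 / (1 - ‖z‖ ^ 2)

end RandomSum

end

noncomputable section

namespace RandomSum

variable {Ω : Type*} [MeasurableSpace Ω]

/-! This is a Kac–Rice computation that never conditions on an event of probability zero. Write
`S_N(z) = η_0 + T(z)` with `T` built from `η_1, …, η_N`. A point `z` solves the equation exactly
when `η_0 = G(z)`, where `G = K - T`. With the tail frozen, `η_0` still has its Gaussian density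
`φ`, so the expected count is the integral of `φ(w)` times the size of the fibre of `G` over `w`.
The area formula (`lintegral_encard_fiber`), with Jacobian `|G'|²`, turns this into `∫_Φ φ(K - T(z))
|T'(z)|²`. Averaging over the tail and swapping integrals gives the density `E[φ(K - T(z))
|T'(z)|²]`.

`lintegral_density_mul_norm_sq` evaluates this expectation by Gaussian regression. Since `η_0` has
derivative zero, `T' = S_N'`, and `S_N' = γ S_N + W` with `W` independent of `S_N`. The expectation
is therefore the Gaussian density of `S_N(z)` at `K` times `E|γK + W|²`. It depends only on the
three sums `kernel₀`, `kernel₁`, `kernel₂`. For `|z| < 1`, with `r = |z|²`, `kernel₀`, `|kernel₁|²`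
and `kernel₂` tend to `B`, `r B⁴` and `(1 + r) B³`, which gives the limit. Uniqueness holds because
a continuous function is determined by its integrals over compact sets. -/

/-! ### Measurability of the number of zeros -/

/-- The projection of the zero set of a Carathéodory function over a compact set is measurable. -/
lemma measurableSet_exists_zero {X : Type*} [MeasurableSpace X] {F : X → ℂ → ℂ}
    (hF : ∀ z, Measurable fun x => F x z) (hc : ∀ x, Continuous (F x)) {C : Set ℂ}
    (hC : IsCompact C) : MeasurableSet {x | ∃ z ∈ C, F x z = 0} := by
  rcases C.eq_empty_or_nonempty with rfl | hne
  · simp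
  have : Nonempty C := hne.to_subtype
  -- On a compact set `|F|` attains its minimum, so a zero exists iff the infimum over a countable
  -- dense subset is zero.
  have key : {x | ∃ z ∈ C, F x z = 0} =
      ⋂ n : ℕ, ⋃ k : ℕ, {x | ‖F x (TopologicalSpace.denseSeq C k)‖ < 1 / ((n : ℝ) + 1)} := by
    ext x
    simp only [Set.mem_ofPred_eq, Set.mem_iInter, Set.mem_iUnion]
    constructor
    · rintro ⟨z, hz, h0⟩ n
      have hopen : IsOpen {y : C | ‖F x y‖ < 1 / ((n : ℝ) + 1)} :=
        isOpen_lt (((hc x).comp continuous_subtype_val).norm) continuous_const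
      exact (TopologicalSpace.denseRange_denseSeq C).exists_mem_open hopen
        ⟨⟨z, hz⟩, by simp only [Set.mem_ofPred_eq, h0, norm_zero]; positivity⟩
    · intro h
      obtain ⟨z, hz, hmin⟩ := hC.exists_isMinOn hne (hc x).norm.continuousOn
      refine ⟨z, hz, ?_⟩
      by_contra hne0
      obtain ⟨n, hn⟩ := exists_nat_one_div_lt (norm_pos_iff.mpr hne0)
      obtain ⟨k, hk⟩ := h n
      have := hmin (TopologicalSpace.denseSeq C k).2
      simp only [Set.mem_ofPred_eq] at this
      linarith
  rw [key]
  exact MeasurableSet.iInter fun n => MeasurableSet.iUnion fun k =>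
    measurableSet_lt (hF _).norm measurable_const

/-- A countable family of compact discs, refining every neighbourhood of every point. -/
def rationalDisc (i : ℕ × ℕ) : Set ℂ :=
  Metric.closedBall (TopologicalSpace.denseSeq ℂ i.1) (1 / ((i.2 : ℝ) + 1))

lemma exists_rationalDisc_subset {U : Set ℂ} (hU : IsOpen U) {z : ℂ} (hz : z ∈ U) :
    ∃ i, z ∈ rationalDisc i ∧ rationalDisc i ⊆ U := by
  obtain ⟨ε, hε, hsub⟩ := Metric.isOpen_iff.mp hU z hz
  obtain ⟨m, hm⟩ := exists_nat_one_div_lt (half_pos hε)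
  have hpos : (0 : ℝ) < 1 / ((m : ℝ) + 1) := by positivity
  obtain ⟨k, hk⟩ := (TopologicalSpace.denseRange_denseSeq ℂ).exists_dist_lt z hpos
  refine ⟨(k, m), hk.le, fun w hw => hsub ?_⟩
  have hw' : dist w (TopologicalSpace.denseSeq ℂ k) ≤ 1 / ((m : ℝ) + 1) := hw
  rw [Metric.mem_ball]
  have := dist_triangle_right w z (TopologicalSpace.denseSeq ℂ k)
  linarith

/-- The cardinality of a plane set as a supremum of counts of disjoint discs which meet it. -/
lemma encard_eq_iSup_rationalDisc (Z : Set ℂ) :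
    (Z.encard : ENNReal) =
      ⨆ S : {S : Finset (ℕ × ℕ) // (S : Set (ℕ × ℕ)).PairwiseDisjoint rationalDisc},
        ∑ i ∈ S.1, {i | (Z ∩ rationalDisc i).Nonempty}.indicator (fun _ => (1 : ENNReal)) i := by
  classical
  apply le_antisymm
  · have hfin : ∀ t : Set ℂ, t ⊆ Z → t.Finite → (t.encard : ENNReal) ≤
        ⨆ S : {S : Finset (ℕ × ℕ) // (S : Set (ℕ × ℕ)).PairwiseDisjoint rationalDisc},
          ∑ i ∈ S.1, {i | (Z ∩ rationalDisc i).Nonempty}.indicator (fun _ => (1 : ENNReal)) i := by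
      intro t htZ ht
      obtain ⟨U, hU, hdis⟩ := ht.t2_separation
      choose! ι hι using fun z => exists_rationalDisc_subset (hU z).2 (hU z).1
      have hinj : Set.InjOn ι t := by
        intro x hx y hy hxy
        by_contra hne
        have h1 := (hι x).2 (hι x).1
        have h2 := (hι y).2 (hxy ▸ (hι x).1)
        exact Set.disjoint_left.mp (hdis hx hy hne) h1 h2
      have hS : ((ht.toFinset.image ι : Finset (ℕ × ℕ)) : Set (ℕ × ℕ)).PairwiseDisjoint
          rationalDisc := by
        simp only [Finset.coe_image, Set.Finite.coe_toFinset]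
        rintro _ ⟨x, hx, rfl⟩ _ ⟨y, hy, rfl⟩ hne
        exact (hdis hx hy (fun h => hne (h ▸ rfl))).mono (hι x).2 (hι y).2
      refine le_trans ?_ (le_iSup _ ⟨_, hS⟩)
      rw [Finset.sum_image (by simpa using hinj)]
      rw [Finset.sum_congr rfl (g := fun _ => (1 : ENNReal))]
      · rw [Finset.sum_const, ht.encard_eq_coe_toFinset_card]
        simp
      · intro x hx
        have hx' : x ∈ t := by simpa using hx
        exact Set.indicator_of_mem (s := {i | (Z ∩ rationalDisc i).Nonempty})
          (show (Z ∩ rationalDisc (ι x)).Nonempty from ⟨x, htZ hx', (hι x).1⟩) _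
    rcases Z.finite_or_infinite with hZ | hZ
    · exact hfin Z subset_rfl hZ
    · refine le_of_eq_of_le (b := ⊤) (by simp [hZ.encard_eq]) ?_
      refine (ENNReal.eq_top_of_forall_nnreal_le fun r => ?_).ge
      obtain ⟨n, hn⟩ := exists_nat_ge r
      obtain ⟨t, htZ, ht⟩ := hZ.exists_subset_card_eq n
      refine le_trans ?_ (hfin t htZ t.finite_toSet)
      simp only [Set.encard_coe_eq_coe_finsetCard, ht]
      simpa using (by exact_mod_cast hn : (r : ENNReal) ≤ (n : ENNReal))
  · refine iSup_le fun ⟨S, hS⟩ => ?_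
    -- Restricting the counting measure to `Z` gives additivity over the disjoint closed discs
    -- without assuming `Z` measurable.
    have hle : ∀ A : Set ℂ, (Measure.count.restrict Z) A ≤ (Z.encard : ENNReal) := fun A =>
      (measure_mono (Set.subset_univ _)).trans (by
        rw [Measure.restrict_apply MeasurableSet.univ, Set.univ_inter]
        rcases Z.finite_or_infinite with hZ | hZ
        · rw [Measure.count_apply hZ.measurableSet]
        · simp [hZ.encard_eq])
    refine le_trans ?_ (hle (⋃ i ∈ S, rationalDisc i))
    rw [measure_biUnion_finset hS fun i _ => Metric.isClosed_closedBall.measurableSet]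
    refine Finset.sum_le_sum fun i _ => ?_
    by_cases hi : (Z ∩ rationalDisc i).Nonempty
    · obtain ⟨x, hxZ, hxi⟩ := hi
      refine (Set.indicator_le_self' (fun _ _ => zero_le) i).trans ?_
      rw [Measure.restrict_apply (show MeasurableSet (rationalDisc i) from
        Metric.isClosed_closedBall.measurableSet)]
      calc (1 : ENNReal) = Measure.count ({x} : Set ℂ) := by simp
        _ ≤ _ := measure_mono (by simpa using ⟨hxi, hxZ⟩)
    · rw [Set.indicator_of_notMem (by simpa using hi)]
      exact zero_le

/-- The number of zeros in a compact set of a Carathéodory function is measurable. -/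
lemma measurable_encard_zeros {X : Type*} [MeasurableSpace X] {F : X → ℂ → ℂ}
    (hF : ∀ z, Measurable fun x => F x z) (hc : ∀ x, Continuous (F x)) {Φ : Set ℂ}
    (hΦ : IsCompact Φ) : Measurable fun x => ({z ∈ Φ | F x z = 0}.encard : ENNReal) := by
  simp_rw [encard_eq_iSup_rationalDisc]
  refine Measurable.iSup fun S => Finset.measurable_sum _ fun i _ => ?_
  have hmeas := measurableSet_exists_zero hF hc
    (hΦ.inter_right (t := rationalDisc i) Metric.isClosed_closedBall)
  convert (measurable_const (a := (1 : ENNReal))).indicator hmeas using 1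
  ext x
  have hiff : ({z ∈ Φ | F x z = 0} ∩ rationalDisc i).Nonempty ↔
      ∃ z ∈ Φ ∩ rationalDisc i, F x z = 0 :=
    ⟨fun ⟨z, hz, hzi⟩ => ⟨z, ⟨hz.1, hzi⟩, hz.2⟩, fun ⟨z, hz, h0⟩ => ⟨z, ⟨hz.1, h0⟩, hz.2⟩⟩
  classical
  simp only [Set.indicator_apply, Set.mem_ofPred_eq, hiff]

/-! ### The area formula with multiplicities for entire functions -/

lemma det_smulRight_restrictScalars (c : ℂ) :
    (((ContinuousLinearMap.toSpanSingleton ℂ c).restrictScalars ℝ).det : ℝ) = ‖c‖ ^ 2 := by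
  rw [ContinuousLinearMap.det, ← LinearMap.det_toMatrix Complex.basisOneI, Matrix.det_fin_two,
    ← Complex.normSq_eq_norm_sq, Complex.normSq_apply]
  simp [LinearMap.toMatrix_apply]

/-- The area formula for an entire function, weighted by a function on the target. -/
lemma lintegral_encard_fiber {G : ℂ → ℂ} (hG : Differentiable ℂ G) {Φ : Set ℂ}
    (hΦ : MeasurableSet Φ) {φ : ℂ → ENNReal} (hφ : Measurable φ) :
    ∫⁻ w, φ w * ({z ∈ Φ | G z = w}.encard : ENNReal) =
      ∫⁻ z in Φ, ENNReal.ofReal (‖deriv G z‖ ^ 2) * φ (G z) := by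
  have hd : ∀ s x, HasFDerivWithinAt G
      ((ContinuousLinearMap.toSpanSingleton ℂ (deriv G x)).restrictScalars ℝ) s x := fun s x =>
    ((hG x).hasDerivAt.hasFDerivAt.restrictScalars ℝ).hasFDerivWithinAt
  have hG' : Continuous (deriv G) := (hG.contDiff (n := 1)).continuous_deriv le_rfl
  set s : Set ℂ := Φ ∩ {z | deriv G z ≠ 0} with hs
  have hsm : MeasurableSet s :=
    hΦ.inter (isOpen_ne_fun hG' continuous_const).measurableSet
  -- Inverse function theorem: away from critical points `G` is injective on some disc of the
  -- countable family. Disjointifying these discs cuts `s` into countably many pieces on which `G`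
  -- is injective.
  have hloc : ∀ z ∈ {z | deriv G z ≠ 0}, ∃ i, z ∈ rationalDisc i ∧
      Set.InjOn G (rationalDisc i) := by
    intro z hz
    have hst : HasStrictDerivAt G (deriv G z) z :=
      ((hG.contDiff (n := 1)).contDiffAt).hasStrictDerivAt one_ne_zero
    obtain ⟨e, he⟩ : ∃ e : OpenPartialHomeomorph ℂ ℂ, z ∈ e.source ∧ (e : ℂ → ℂ) = G :=
      ⟨(hst.hasStrictFDerivAt_equiv hz).toOpenPartialHomeomorph G,
        (hst.hasStrictFDerivAt_equiv hz).mem_toOpenPartialHomeomorph_source, rfl⟩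
    obtain ⟨i, hzi, hi⟩ := exists_rationalDisc_subset e.open_source he.1
    exact ⟨i, hzi, he.2 ▸ e.injOn.mono hi⟩
  obtain ⟨enum, henum⟩ := exists_surjective_nat (ℕ × ℕ)
  classical
  set D : ℕ → Set ℂ := fun n =>
    if Set.InjOn G (rationalDisc (enum n)) then rationalDisc (enum n) else ∅ with hD
  have hDm : ∀ n, MeasurableSet (D n) := by
    intro n
    simp only [hD]
    split_ifs
    · exact Metric.isClosed_closedBall.measurableSet
    · exact MeasurableSet.empty
  have hDinj : ∀ n, Set.InjOn G (D n) := by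
    intro n
    simp only [hD]
    split_ifs with h
    · exact h
    · exact Set.injOn_empty _
  set t : ℕ → Set ℂ := fun n => s ∩ disjointed D n with ht
  have htm : ∀ n, MeasurableSet (t n) := fun n => hsm.inter (MeasurableSet.disjointed hDm n)
  have htinj : ∀ n, Set.InjOn G (t n) := fun n =>
    (hDinj n).mono (Set.inter_subset_right.trans (disjointed_subset D n))
  have htdis : Pairwise (Function.onFun Disjoint t) := fun i j hij =>
    (disjoint_disjointed D hij).mono Set.inter_subset_right Set.inter_subset_right
  have htU : ⋃ n, t n = s := by
    rw [← Set.inter_iUnion, iUnion_disjointed, Set.inter_eq_left]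
    intro z hz
    obtain ⟨i, hzi, hi⟩ := hloc z hz.2
    obtain ⟨n, rfl⟩ := henum i
    exact Set.mem_iUnion.mpr ⟨n, by simpa only [hD, if_pos hi] using hzi⟩
  -- Sard: critical values are null on the target side, and critical points contribute nothing to
  -- the right-hand integral because the Jacobian vanishes there.
  have hcrit : volume (G '' (Φ ∩ {z | deriv G z = 0})) = 0 := by
    refine addHaar_image_eq_zero_of_det_fderivWithin_eq_zero volume (fun x _ => hd _ x) ?_
    intro x hx
    rw [det_smulRight_restrictScalars, hx.2]
    simp
  have hcount : ∀ᵐ w : ℂ, ({z ∈ Φ | G z = w}.encard : ENNReal) =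
      ∑' n, (G '' t n).indicator (fun _ => (1 : ENNReal)) w := by
    filter_upwards [measure_eq_zero_iff_ae_notMem.mp hcrit] with w hw
    have hset : {z ∈ Φ | G z = w} = ⋃ n, (t n ∩ G ⁻¹' {w}) := by
      rw [← Set.iUnion_inter, htU]
      ext z
      simp only [hs, Set.mem_ofPred_eq, Set.mem_inter_iff, Set.mem_preimage, Set.mem_singleton_iff]
      refine ⟨fun h => ⟨⟨h.1, fun h0 => hw ⟨z, ⟨h.1, h0⟩, h.2⟩⟩, h.2⟩, fun h => ⟨h.1.1, h.2⟩⟩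
    have hm : ∀ n, MeasurableSet (t n ∩ G ⁻¹' {w}) := fun n =>
      (htm n).inter (hG.continuous.measurable (measurableSet_singleton w))
    rw [← Measure.count_apply (hset ▸ MeasurableSet.iUnion hm), hset, measure_iUnion
      (fun i j hij => (htdis hij).mono Set.inter_subset_left Set.inter_subset_left) hm]
    congr 1 with n
    by_cases h : w ∈ G '' t n
    · obtain ⟨z, hz, rfl⟩ := h
      have : t n ∩ G ⁻¹' {G z} = {z} := by
        ext y
        refine ⟨fun hy => htinj n hy.1 hz hy.2, ?_⟩
        rintro rfl
        exact ⟨hz, rfl⟩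
      rw [this, Set.indicator_of_mem (Set.mem_image_of_mem G hz)]
      simp
    · have : t n ∩ G ⁻¹' {w} = ∅ := by
        ext y
        simp only [Set.mem_inter_iff, Set.mem_preimage, Set.mem_singleton_iff,
          Set.mem_empty_iff_false, iff_false]
        exact fun hy => h ⟨y, hy⟩
      rw [this, Set.indicator_of_notMem h]
      simp
  have himm : ∀ n, MeasurableSet (G '' t n) := fun n =>
    (htm n).image_of_continuousOn_injOn hG.continuous.continuousOn (htinj n)
  calc ∫⁻ w, φ w * ({z ∈ Φ | G z = w}.encard : ENNReal)
      = ∫⁻ w, ∑' n, (G '' t n).indicator φ w := by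
        refine lintegral_congr_ae (hcount.mono fun w hw => ?_)
        simp only
        rw [hw, ← ENNReal.tsum_mul_left]
        congr 1 with n
        by_cases h : w ∈ G '' t n <;> simp [h]
    _ = ∑' n, ∫⁻ w in G '' t n, φ w := by
        rw [lintegral_tsum fun n => (hφ.indicator (himm n)).aemeasurable]
        congr 1 with n
        rw [lintegral_indicator (himm n)]
    _ = ∑' n, ∫⁻ z in t n, ENNReal.ofReal (‖deriv G z‖ ^ 2) * φ (G z) := by
        congr 1 with n
        rw [lintegral_image_eq_lintegral_abs_det_fderiv_mul volume (htm n)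
          (fun x _ => hd _ x) (htinj n)]
        simp_rw [det_smulRight_restrictScalars, abs_of_nonneg (sq_nonneg ‖_‖)]
    _ = ∫⁻ z in s, ENNReal.ofReal (‖deriv G z‖ ^ 2) * φ (G z) := by
        rw [← htU, lintegral_iUnion htm htdis]
    _ = ∫⁻ z in Φ, ENNReal.ofReal (‖deriv G z‖ ^ 2) * φ (G z) := by
        rw [hs, Set.inter_comm, ← setLIntegral_indicator
          (isOpen_ne_fun hG' continuous_const).measurableSet]
        congr 1 with z
        by_cases h : deriv G z = 0 <;> simp [h]

/-! ### Linear combinations of independent complex Gaussian variables -/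

/-- The linear combination `∑_{j ≤ N} η_j c_j` with `η_j = a_j + i b_j`. -/
def gaussSum (a b : ℕ → Ω → ℝ) (N : ℕ) (c : ℕ → ℂ) (ω : Ω) : ℂ :=
  ∑ j ∈ Finset.range (N + 1), ((a j ω : ℂ) + (b j ω : ℂ) * Complex.I) * c j

/-- The density of the centred circular Gaussian law on `ℂ` with variance `A` in each coordinate. -/
def circularDensity (A : ℝ) (w : ℂ) : ℝ :=
  1 / (2 * Real.pi * A) * Real.exp (-‖w‖ ^ 2 / (2 * A))

lemma circularDensity_nonneg {A : ℝ} (hA : 0 ≤ A) (w : ℂ) : 0 ≤ circularDensity A w := by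
  unfold circularDensity
  have := Real.pi_pos
  positivity

lemma continuous_circularDensity (A : ℝ) : Continuous (circularDensity A) := by
  unfold circularDensity
  fun_prop

section Gauss

variable {P : Measure Ω} {a b : ℕ → Ω → ℝ} (N : ℕ)

/-- The real Gaussian variables `a_0, …, a_N, b_0, …, b_N`. -/
def gaussCoord (a b : ℕ → Ω → ℝ) (N : ℕ) (i : Fin (N + 1) ⊕ Fin (N + 1)) : Ω → ℝ :=
  Sum.elim a b (Sum.map (fun j : Fin (N + 1) => (j : ℕ)) (fun j : Fin (N + 1) => (j : ℕ)) i)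

/-- The coefficients of the real part of `gaussSum` with respect to `gaussCoord`. -/
def reCoeff (N : ℕ) (c : ℕ → ℂ) : Fin (N + 1) ⊕ Fin (N + 1) → ℝ :=
  Sum.elim (fun j => (c j).re) (fun j => -(c j).im)

omit [MeasurableSpace Ω] in
lemma re_gaussSum (c : ℕ → ℂ) (ω : Ω) :
    (gaussSum a b N c ω).re = ∑ i, reCoeff N c i * gaussCoord a b N i ω := by
  simp only [gaussSum, Finset.sum_range, Complex.re_sum, Fintype.sum_sum_type, reCoeff, gaussCoord,
    Sum.elim_inl, Sum.elim_inr, Sum.map_inl, Sum.map_inr, ← Finset.sum_add_distrib]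
  refine Finset.sum_congr rfl fun j _ => ?_
  simp
  ring

omit [MeasurableSpace Ω] in
lemma mul_gaussSum (x : ℂ) (c : ℕ → ℂ) (ω : Ω) :
    x * gaussSum a b N c ω = gaussSum a b N (fun j => x * c j) ω := by
  simp only [gaussSum, Finset.mul_sum]
  exact Finset.sum_congr rfl fun j _ => by ring

-- Rotating the coefficients by `-i` reduces moment computations for imaginary parts to those for
-- real parts.
omit [MeasurableSpace Ω] in
lemma im_gaussSum (c : ℕ → ℂ) (ω : Ω) :
    (gaussSum a b N c ω).im = (gaussSum a b N (fun j => -Complex.I * c j) ω).re := by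
  rw [← mul_gaussSum]
  simp

variable (hab : IsStdGaussianPair P a b)
include hab

lemma IsStdGaussianPair.hasLaw_gaussCoord (i : Fin (N + 1) ⊕ Fin (N + 1)) :
    HasLaw (gaussCoord a b N i) (gaussianReal 0 1) P := by
  rcases i with j | j
  · exact hab.law_a j
  · exact hab.law_b j

lemma IsStdGaussianPair.iIndepFun_gaussCoord : iIndepFun (gaussCoord a b N) P :=
  hab.indep.precomp (g := Sum.map (fun j : Fin (N + 1) => (j : ℕ)) (fun j : Fin (N + 1) => (j : ℕ)))
    (Sum.map_injective.mpr ⟨Fin.val_injective, Fin.val_injective⟩)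

lemma IsStdGaussianPair.hasGaussianLaw_gaussCoord :
    HasGaussianLaw (fun ω => (gaussCoord a b N · ω)) P :=
  (hab.iIndepFun_gaussCoord N).hasGaussianLaw fun i => (hab.hasLaw_gaussCoord N i).hasGaussianLaw

/-- A real-linear image of a Gaussian vector is Gaussian. Joint Gaussianity is what lets vanishing
covariance yield independence later. -/
lemma IsStdGaussianPair.hasGaussianLaw_gaussSum_prod (c d : ℕ → ℂ) :
    HasGaussianLaw (fun ω => (gaussSum a b N c ω, gaussSum a b N d ω)) P := by
  let L : (ℕ → ℂ) → (Fin (N + 1) ⊕ Fin (N + 1) → ℝ) →L[ℝ] ℂ := fun c =>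
    ∑ j : Fin (N + 1), ((ContinuousLinearMap.proj (R := ℝ) (φ := fun _ => ℝ)
      (Sum.inl j : Fin (N + 1) ⊕ Fin (N + 1))).smulRight (c j) +
      (ContinuousLinearMap.proj (R := ℝ) (φ := fun _ => ℝ)
      (Sum.inr j : Fin (N + 1) ⊕ Fin (N + 1))).smulRight (Complex.I * c j))
  have hL : ∀ c ω, L c (gaussCoord a b N · ω) = gaussSum a b N c ω := by
    intro c ω
    simp only [L, gaussSum, Finset.sum_range, sum_apply,
      add_apply, ContinuousLinearMap.smulRight_apply,
      ContinuousLinearMap.proj_apply, gaussCoord, Sum.map_inl, Sum.map_inr, Sum.elim_inl,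
      Sum.elim_inr, Complex.real_smul]
    exact Finset.sum_congr rfl fun j _ => by ring
  have := (hab.hasGaussianLaw_gaussCoord N).map_fun ((L c).prod (L d))
  simpa only [ContinuousLinearMap.prod_apply, hL] using this

lemma IsStdGaussianPair.hasGaussianLaw_gaussSum (c : ℕ → ℂ) :
    HasGaussianLaw (gaussSum a b N c) P :=
  (hab.hasGaussianLaw_gaussSum_prod N c c).fst

lemma IsStdGaussianPair.hasGaussianLaw_re_gaussSum (c : ℕ → ℂ) :
    HasGaussianLaw (fun ω => (gaussSum a b N c ω).re) P :=
  (hab.hasGaussianLaw_gaussSum N c).map_fun Complex.reCLM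

/-- The real coordinates are orthonormal in `L²`, so the covariance is the dot product of the real
coefficient vectors. -/
lemma IsStdGaussianPair.covariance_re_gaussSum (c d : ℕ → ℂ) :
    cov[fun ω => (gaussSum a b N c ω).re, fun ω => (gaussSum a b N d ω).re; P] =
      (∑ j ∈ Finset.range (N + 1), c j * starRingEnd ℂ (d j)).re := by
  have hP : IsProbabilityMeasure P := (hab.law_a 0).isProbabilityMeasure
  have hmem : ∀ i, MemLp (gaussCoord a b N i) 2 P := fun i =>
    ((hab.hasLaw_gaussCoord N i).hasGaussianLaw).memLp_two
  have hcov : ∀ i k, cov[gaussCoord a b N i, gaussCoord a b N k; P] = if i = k then 1 else 0 := by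
    intro i k
    split_ifs with h
    · subst h
      rw [covariance_self (hmem i).aemeasurable, (hab.hasLaw_gaussCoord N i).variance_eq]
      simp
    · exact ((hab.iIndepFun_gaussCoord N).indepFun h).covariance_eq_zero (hmem i) (hmem k)
  simp_rw [re_gaussSum]
  rw [covariance_fun_sum_fun_sum (fun i => (hmem i).const_mul _) fun i => (hmem i).const_mul _]
  simp_rw [covariance_const_mul_left, covariance_const_mul_right, hcov]
  simp only [mul_ite, mul_one, mul_zero, Finset.sum_ite_eq, Finset.mem_univ, if_true,
    Finset.sum_range, Complex.re_sum, Fintype.sum_sum_type, reCoeff, Sum.elim_inl, Sum.elim_inr,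
    ← Finset.sum_add_distrib]
  exact Finset.sum_congr rfl fun j _ => by simp

lemma IsStdGaussianPair.integral_re_gaussSum (c : ℕ → ℂ) :
    ∫ ω, (gaussSum a b N c ω).re ∂P = 0 := by
  simp_rw [re_gaussSum]
  rw [integral_finsetSum _ fun i _ =>
    ((hab.hasLaw_gaussCoord N i).hasGaussianLaw).integrable.const_mul _]
  refine Finset.sum_eq_zero fun i _ => ?_
  rw [integral_const_mul, (hab.hasLaw_gaussCoord N i).integral_eq]
  simp

/-- Pairing with directions `x` and `y` only multiplies the Hermitian sum by `x̄ y`. One complex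
orthogonality relation thus kills every real cross-covariance. -/
lemma IsStdGaussianPair.indepFun_gaussSum {c d : ℕ → ℂ}
    (h : ∑ j ∈ Finset.range (N + 1), c j * starRingEnd ℂ (d j) = 0) :
    IndepFun (gaussSum a b N c) (gaussSum a b N d) P := by
  refine (hab.hasGaussianLaw_gaussSum_prod N c d).indepFun_of_covariance_inner fun x y => ?_
  have hinner : ∀ (x : ℂ) (c : ℕ → ℂ) ω, inner ℝ x (gaussSum a b N c ω) =
      (gaussSum a b N (fun j => starRingEnd ℂ x * c j) ω).re := by
    intro x c ω
    rw [Complex.inner, ← mul_gaussSum, mul_comm]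
  simp_rw [hinner]
  rw [hab.covariance_re_gaussSum]
  have : ∑ j ∈ Finset.range (N + 1), starRingEnd ℂ x * c j * starRingEnd ℂ (starRingEnd ℂ y * d j) =
      starRingEnd ℂ x * y * ∑ j ∈ Finset.range (N + 1), c j * starRingEnd ℂ (d j) := by
    rw [Finset.mul_sum]
    exact Finset.sum_congr rfl fun j _ => by simp; ring
  rw [this, h]
  simp

lemma IsStdGaussianPair.map_re_gaussSum (c : ℕ → ℂ) :
    P.map (fun ω => (gaussSum a b N c ω).re) =
      gaussianReal 0 (∑ j ∈ Finset.range (N + 1), ‖c j‖ ^ 2).toNNReal := by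
  rw [(hab.hasGaussianLaw_re_gaussSum N c).map_eq_gaussianReal, hab.integral_re_gaussSum,
    ← covariance_self (hab.hasGaussianLaw_re_gaussSum N c).aemeasurable,
    hab.covariance_re_gaussSum]
  congr 2
  rw [Complex.re_sum]
  exact Finset.sum_congr rfl fun j _ => by
    rw [Complex.mul_conj, Complex.ofReal_re, Complex.normSq_eq_norm_sq]

omit hab in
lemma gaussianPDFReal_mul_gaussianPDFReal {A : ℝ} (hA : 0 < A) (w : ℂ) :
    gaussianPDFReal 0 A.toNNReal w.re * gaussianPDFReal 0 A.toNNReal w.im =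
      circularDensity A w := by
  simp only [gaussianPDFReal, circularDensity, Real.coe_toNNReal A hA.le, sub_zero]
  have h2 : (0 : ℝ) ≤ 2 * Real.pi * A := by have := Real.pi_pos; positivity
  rw [mul_mul_mul_comm, ← Real.exp_add, ← mul_inv, Real.mul_self_sqrt h2, ← Complex.normSq_eq_norm_sq,
    Complex.normSq_apply, one_div]
  congr 2
  ring

lemma IsStdGaussianPair.hasLaw_gaussSum {c : ℕ → ℂ} {A : ℝ} (hA : 0 < A)
    (hc : ∑ j ∈ Finset.range (N + 1), ‖c j‖ ^ 2 = A) :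
    HasLaw (gaussSum a b N c)
      ((volume : Measure ℂ).withDensity fun w => ENNReal.ofReal (circularDensity A w)) P := by
  have hP : IsProbabilityMeasure P := (hab.law_a 0).isProbabilityMeasure
  have hre := hab.map_re_gaussSum N c
  have him := hab.map_re_gaussSum N (fun j => -Complex.I * c j)
  simp_rw [← im_gaussSum] at him
  simp only [norm_mul, norm_neg, Complex.norm_I, one_mul, hc] at hre him
  have hpair : HasGaussianLaw (fun ω => ((gaussSum a b N c ω).re, (gaussSum a b N c ω).im)) P :=
    (hab.hasGaussianLaw_gaussSum N c).map_fun (Complex.reCLM.prod Complex.imCLM)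
  -- Circularity: each term of the covariance is the real part of the imaginary number `i |c_j|²`.
  have hind : IndepFun (fun ω => (gaussSum a b N c ω).re) (fun ω => (gaussSum a b N c ω).im) P := by
    refine hpair.indepFun_of_covariance_eq_zero ?_
    simp_rw [im_gaussSum]
    rw [hab.covariance_re_gaussSum, Complex.re_sum]
    refine Finset.sum_eq_zero fun j _ => ?_
    simp
    ring
  have hA0 : A.toNNReal ≠ 0 := by simpa using hA
  refine ⟨(hab.hasGaussianLaw_gaussSum N c).aemeasurable, ?_⟩
  have hprod : P.map (fun ω => ((gaussSum a b N c ω).re, (gaussSum a b N c ω).im)) =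
      ((volume : Measure ℝ).prod volume).withDensity (fun p : ℝ × ℝ =>
        gaussianPDF 0 A.toNNReal p.1 * gaussianPDF 0 A.toNNReal p.2) := by
    rw [hind.map_prod_eq_prod_map_map hpair.fst.aemeasurable hpair.snd.aemeasurable, hre, him,
      gaussianReal_of_var_ne_zero 0 hA0,
      prod_withDensity (measurable_gaussianPDF 0 _) (measurable_gaussianPDF 0 _)]
  have hcomp : gaussSum a b N c = Complex.measurableEquivRealProd.symm ∘
      (fun ω => ((gaussSum a b N c ω).re, (gaussSum a b N c ω).im)) := by
    ext ω
    exact (Complex.measurableEquivRealProd.symm_apply_apply _).symm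
  rw [hcomp, ← AEMeasurable.map_map_of_aemeasurable
    Complex.measurableEquivRealProd.symm.measurable.aemeasurable hpair.aemeasurable, hprod]
  ext s hs
  rw [MeasurableEquiv.map_apply, withDensity_apply _ (Complex.measurableEquivRealProd.symm.measurable hs), withDensity_apply _ hs,
    ← Complex.volume_preserving_equiv_real_prod.symm.setLIntegral_comp_preimage_emb
      (MeasurableEquiv.measurableEmbedding _)]
  refine lintegral_congr fun p => ?_
  rw [← gaussianPDFReal_mul_gaussianPDFReal hA, ENNReal.ofReal_mul (gaussianPDFReal_nonneg _ _ _)]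
  rfl

lemma IsStdGaussianPair.integrable_norm_sq_gaussSum (c : ℕ → ℂ) :
    Integrable (fun ω => ‖gaussSum a b N c ω‖ ^ 2) P :=
  (hab.hasGaussianLaw_gaussSum N c).memLp_two.integrable_norm_pow two_ne_zero

lemma IsStdGaussianPair.integral_norm_sq_gaussSum (c : ℕ → ℂ) :
    ∫ ω, ‖gaussSum a b N c ω‖ ^ 2 ∂P = 2 * ∑ j ∈ Finset.range (N + 1), ‖c j‖ ^ 2 := by
  have hvar : ∀ c : ℕ → ℂ, ∫ ω, (gaussSum a b N c ω).re ^ 2 ∂P =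
      ∑ j ∈ Finset.range (N + 1), ‖c j‖ ^ 2 := by
    intro c
    have h := hab.covariance_re_gaussSum N c c
    rw [covariance_self (hab.hasGaussianLaw_re_gaussSum N c).aemeasurable,
      variance_of_integral_eq_zero (hab.hasGaussianLaw_re_gaussSum N c).aemeasurable
        (hab.integral_re_gaussSum N c)] at h
    rw [h, Complex.re_sum]
    exact Finset.sum_congr rfl fun j _ => by
      rw [Complex.mul_conj, Complex.ofReal_re, Complex.normSq_eq_norm_sq]
  have hint : ∀ c : ℕ → ℂ, Integrable (fun ω => (gaussSum a b N c ω).re ^ 2) P := fun c =>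
    (hab.hasGaussianLaw_re_gaussSum N c).memLp_two.integrable_sq
  have hsplit : ∀ ω, ‖gaussSum a b N c ω‖ ^ 2 = (gaussSum a b N c ω).re ^ 2 +
      (gaussSum a b N (fun j => -Complex.I * c j) ω).re ^ 2 := by
    intro ω
    rw [← im_gaussSum, ← Complex.normSq_eq_norm_sq, Complex.normSq_apply]
    ring
  simp_rw [hsplit]
  rw [integral_add (hint _) (hint _), hvar, hvar]
  simp
  ring

/-- The cross term is the real part of a centred sum and integrates to zero; the factor 2 counts the
two real coordinates. -/
lemma IsStdGaussianPair.lintegral_norm_sq_add_gaussSum (k : ℂ) (c : ℕ → ℂ) :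
    ∫⁻ ω, ENNReal.ofReal (‖k + gaussSum a b N c ω‖ ^ 2) ∂P =
      ENNReal.ofReal (‖k‖ ^ 2 + 2 * ∑ j ∈ Finset.range (N + 1), ‖c j‖ ^ 2) := by
  have hP : IsProbabilityMeasure P := (hab.law_a 0).isProbabilityMeasure
  have hexp : ∀ ω, ‖k + gaussSum a b N c ω‖ ^ 2 = ‖k‖ ^ 2 +
      2 * (gaussSum a b N (fun j => starRingEnd ℂ k * c j) ω).re + ‖gaussSum a b N c ω‖ ^ 2 := by
    intro ω
    rw [norm_add_sq_real, Complex.inner, ← mul_gaussSum, mul_comm (starRingEnd ℂ k)]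
  have h1 : Integrable (fun ω => ‖k‖ ^ 2 +
      2 * (gaussSum a b N (fun j => starRingEnd ℂ k * c j) ω).re) P :=
    (integrable_const _).add ((hab.hasGaussianLaw_re_gaussSum N _).integrable.const_mul 2)
  have h2 := hab.integrable_norm_sq_gaussSum N c
  rw [← ofReal_integral_eq_lintegral_ofReal]
  · congr 1
    simp_rw [hexp]
    rw [integral_add h1 h2, integral_add (integrable_const _)
      ((hab.hasGaussianLaw_re_gaussSum N _).integrable.const_mul 2), integral_const_mul,
      hab.integral_re_gaussSum, hab.integral_norm_sq_gaussSum]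
    simp
  · simp_rw [hexp]
    exact h1.add h2
  · exact ae_of_all _ fun ω => by positivity

end Gauss

/-! ### Integrating out an independent variable -/

/-- Integrating out a variable with a density, independent of the rest. -/
lemma lintegral_of_indepFun_of_hasLaw_withDensity {P : Measure Ω} [IsProbabilityMeasure P]
    {β : Type*} [MeasurableSpace β] {X : Ω → ℂ} {Y : Ω → β} {ρ : ℂ → ENNReal} (hρ : Measurable ρ)
    (hX : HasLaw X ((volume : Measure ℂ).withDensity ρ) P) (hY : AEMeasurable Y P)
    (hXY : IndepFun X Y P) {F : ℂ → β → ENNReal} (hF : Measurable (Function.uncurry F)) :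
    ∫⁻ ω, F (X ω) (Y ω) ∂P = ∫⁻ ω, (∫⁻ w, ρ w * F w (Y ω)) ∂P := by
  have : IsProbabilityMeasure (P.map Y) := Measure.isProbabilityMeasure_map hY
  have : IsProbabilityMeasure (P.map X) := Measure.isProbabilityMeasure_map hX.aemeasurable
  calc ∫⁻ ω, F (X ω) (Y ω) ∂P
      = ∫⁻ p, Function.uncurry F p ∂(P.map fun ω => (X ω, Y ω)) := by
        rw [lintegral_map' hF.aemeasurable (hX.aemeasurable.prodMk hY)]
        rfl
    _ = ∫⁻ y, ∫⁻ w, F w y ∂(P.map X) ∂(P.map Y) := by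
        rw [hXY.map_prod_eq_prod_map_map hX.aemeasurable hY, lintegral_prod_symm' _ hF]
        rfl
    _ = ∫⁻ ω, ∫⁻ w, F w (Y ω) ∂(P.map X) ∂P := by
        rw [lintegral_map' _ hY]
        exact (hF.lintegral_prod_left').aemeasurable
    _ = _ := by
        rw [hX.map_eq]
        refine lintegral_congr fun ω => ?_
        exact lintegral_withDensity_eq_lintegral_mul _ hρ
          (show Measurable fun w => F w (Y ω) from hF.comp measurable_prodMk_right)

/-! ### Splitting off the constant coefficient -/

/-- The constant coefficient `η_0`. -/
def gaussHead (a b : ℕ → Ω → ℝ) (ω : Ω) : ℂ := (a 0 ω : ℂ) + (b 0 ω : ℂ) * Complex.I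

/-- The coefficients `η_1, …, η_N`. -/
def gaussTail (a b : ℕ → Ω → ℝ) (N : ℕ) (ω : Ω) (j : Fin N) : ℂ :=
  (a (j + 1) ω : ℂ) + (b (j + 1) ω : ℂ) * Complex.I

/-- The combination `∑_{1 ≤ j ≤ N} y_j c_j`. -/
def tailSum {N : ℕ} (y : Fin N → ℂ) (c : ℕ → ℂ) : ℂ := ∑ j, y j * c (j + 1)

lemma measurable_tailSum {N : ℕ} (c : ℕ → ℂ) : Measurable fun y : Fin N → ℂ => tailSum y c := by
  unfold tailSum
  fun_prop

omit [MeasurableSpace Ω] in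
lemma gaussSum_eq_head_add_tail (a b : ℕ → Ω → ℝ) (N : ℕ) (c : ℕ → ℂ) (ω : Ω) :
    gaussSum a b N c ω = gaussHead a b ω * c 0 + tailSum (gaussTail a b N ω) c := by
  rw [gaussSum, Finset.sum_range_succ', Finset.sum_range, add_comm]
  rfl

/-- Interchanging an integral over the plane with an expectation. -/
lemma lintegral_lintegral_comp_swap {P : Measure Ω} [IsProbabilityMeasure P]
    {β : Type*} [MeasurableSpace β] {Y : Ω → β} (hY : AEMeasurable Y P) (μ : Measure ℂ) [SFinite μ]
    {F : ℂ → β → ENNReal} (hF : Measurable (Function.uncurry F)) :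
    ∫⁻ ω, (∫⁻ w, F w (Y ω) ∂μ) ∂P = ∫⁻ w, (∫⁻ ω, F w (Y ω) ∂P) ∂μ := by
  have : IsProbabilityMeasure (P.map Y) := Measure.isProbabilityMeasure_map hY
  have h : ∀ w, ∫⁻ ω, F w (Y ω) ∂P = ∫⁻ y, F w y ∂(P.map Y) := fun w =>
    (lintegral_map' (f := F w)
      (show Measurable (F w) from hF.comp measurable_prodMk_left).aemeasurable hY).symm
  simp_rw [h]
  rw [lintegral_lintegral_swap hF.aemeasurable, lintegral_map' _ hY]
  exact (hF.lintegral_prod_left').aemeasurable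

section

variable {P : Measure Ω} {a b : ℕ → Ω → ℝ} (N : ℕ) (hab : IsStdGaussianPair P a b)
include hab

lemma IsStdGaussianPair.aemeasurable_gaussTail : AEMeasurable (gaussTail a b N) P := by
  refine aemeasurable_pi_lambda _ fun j => ?_
  have h1 := (hab.law_a (j + 1)).aemeasurable
  have h2 := (hab.law_b (j + 1)).aemeasurable
  unfold gaussTail
  fun_prop

lemma IsStdGaussianPair.hasLaw_gaussHead : HasLaw (gaussHead a b)
    ((volume : Measure ℂ).withDensity fun w => ENNReal.ofReal (circularDensity 1 w)) P := by
  have h := hab.hasLaw_gaussSum 0 (c := fun _ => 1) one_pos (by simp)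
  refine h.congr (ae_of_all _ fun ω => ?_)
  simp [gaussSum, gaussHead]

lemma IsStdGaussianPair.indepFun_gaussHead_gaussTail :
    IndepFun (gaussHead a b) (gaussTail a b N) P := by
  have hmeas : ∀ i, AEMeasurable (Sum.elim a b i) P := by
    rintro (j | j)
    · exact (hab.law_a j).aemeasurable
    · exact (hab.law_b j).aemeasurable
  have h := hab.indep.indepFun_finset₀ (Finset.disjSum {0} {0})
    (Finset.disjSum (Finset.Icc 1 N) (Finset.Icc 1 N)) (by
      rw [Finset.disjoint_left]
      rintro (j | j) h1 h2 <;> simp_all) hmeas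
  refine h.comp
    (φ := fun p => (p ⟨Sum.inl 0, by simp⟩ : ℂ) + (p ⟨Sum.inr 0, by simp⟩ : ℂ) * Complex.I)
    (ψ := fun p (j : Fin N) =>
      (p ⟨Sum.inl (j + 1), by simp⟩ : ℂ) +
      (p ⟨Sum.inr (j + 1), by simp⟩ : ℂ) * Complex.I) ?_ ?_
  · fun_prop
  · fun_prop

/-! ### The Kac–Rice integrand by Gaussian regression -/

/-- The expectation of `φ(K - ∑_{j ≥ 1} η_j c_j) |∑_{j ≥ 1} η_j d_j|²`, where `φ` is the density of
`η_0` and `c_0 = 1`, in closed form. -/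
lemma IsStdGaussianPair.lintegral_density_mul_norm_sq {c d : ℕ → ℂ} (hc : c 0 = 1) (hd : d 0 = 0)
    {A : ℝ} (hA : ∑ j ∈ Finset.range (N + 1), ‖c j‖ ^ 2 = A) {M : ℂ}
    (hM : ∑ j ∈ Finset.range (N + 1), d j * starRingEnd ℂ (c j) = M) {D : ℝ}
    (hD : ∑ j ∈ Finset.range (N + 1), ‖d j‖ ^ 2 = D) (K : ℂ) :
    ∫⁻ ω, ENNReal.ofReal (circularDensity 1 (K - tailSum (gaussTail a b N ω) c)) *
        ENNReal.ofReal (‖tailSum (gaussTail a b N ω) d‖ ^ 2) ∂P =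
      ENNReal.ofReal (circularDensity A K *
        (‖M‖ ^ 2 / A ^ 2 * ‖K‖ ^ 2 + 2 * (D - ‖M‖ ^ 2 / A))) := by
  have hP : IsProbabilityMeasure P := (hab.law_a 0).isProbabilityMeasure
  have hApos : 0 < A := by
    rw [← hA]
    refine Finset.sum_pos' (fun j _ => by positivity) ⟨0, by simp, by simp [hc]⟩
  -- The regression coefficient: `d - γ c` is the component of `d` Hermitian-orthogonal to `c`, with
  -- squared length `D - |M|²/A`.
  set γ : ℂ := M / A with hγ
  have hAC : (A : ℂ) ≠ 0 := by exact_mod_cast hApos.ne'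
  have hγn : ‖γ‖ ^ 2 = ‖M‖ ^ 2 / A ^ 2 := by
    rw [hγ, norm_div, Complex.norm_real, Real.norm_of_nonneg hApos.le, div_pow]
  have hAsum : ∑ j ∈ Finset.range (N + 1), c j * starRingEnd ℂ (c j) = (A : ℂ) := by
    rw [← hA, Complex.ofReal_sum]
    exact Finset.sum_congr rfl fun j _ => by rw [Complex.mul_conj']; push_cast; rfl
  have hres : ∑ j ∈ Finset.range (N + 1), ‖d j - γ * c j‖ ^ 2 = D - ‖M‖ ^ 2 / A := by
    have hterm : ∀ j, ‖d j - γ * c j‖ ^ 2 = ‖d j‖ ^ 2 -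
        2 * (starRingEnd ℂ γ * (d j * starRingEnd ℂ (c j))).re + ‖γ‖ ^ 2 * ‖c j‖ ^ 2 := by
      intro j
      rw [norm_sub_sq_real, real_inner_comm, Complex.inner, map_mul, norm_mul, mul_pow]
      ring_nf
    simp_rw [hterm]
    rw [Finset.sum_add_distrib, Finset.sum_sub_distrib, ← Finset.mul_sum, ← Finset.mul_sum,
      ← Complex.re_sum, ← Finset.mul_sum, hM, hA, hD, hγn]
    have : starRingEnd ℂ γ * M = ((‖M‖ ^ 2 / A : ℝ) : ℂ) := by
      rw [hγ, map_div₀, Complex.conj_ofReal, div_mul_eq_mul_div, Complex.conj_mul']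
      push_cast
      rfl
    rw [this, Complex.ofReal_re]
    field_simp
    ring
  have hlawT := hab.hasLaw_gaussSum N hApos hA
  have hind : IndepFun (gaussSum a b N c) (gaussSum a b N fun j => d j - γ * c j) P := by
    refine (hab.indepFun_gaussSum N ?_).symm
    simp_rw [sub_mul, mul_assoc]
    rw [Finset.sum_sub_distrib, ← Finset.mul_sum, hM, hAsum, hγ]
    field_simp
    ring
  have hV : ∀ ω, tailSum (gaussTail a b N ω) d =
      γ * gaussSum a b N c ω + gaussSum a b N (fun j => d j - γ * c j) ω := by
    intro ω
    have : tailSum (gaussTail a b N ω) d = gaussSum a b N d ω := by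
      rw [gaussSum_eq_head_add_tail, hd, mul_zero, zero_add]
    rw [this, mul_gaussSum]
    simp only [gaussSum, ← Finset.sum_add_distrib]
    exact Finset.sum_congr rfl fun j _ => by ring
  have hT : ∀ ω, gaussSum a b N c ω = gaussHead a b ω + tailSum (gaussTail a b N ω) c := by
    intro ω
    rw [gaussSum_eq_head_add_tail, hc, mul_one]
  have htail := hab.aemeasurable_gaussTail N
  have hφc := continuous_circularDensity
  have hφm : ∀ A, Measurable fun w => ENNReal.ofReal (circularDensity A w) := fun A =>
    (hφc A).measurable.ennreal_ofReal
  have hcm : Measurable fun y : Fin N → ℂ => tailSum y c := measurable_tailSum c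
  have hdm : Measurable fun y : Fin N → ℂ => tailSum y d := measurable_tailSum d
  set R : ℂ → ℝ := fun k => circularDensity A k *
    (‖M‖ ^ 2 / A ^ 2 * ‖k‖ ^ 2 + 2 * (D - ‖M‖ ^ 2 / A)) with hR
  set q : ℂ → ENNReal := fun k =>
    ∫⁻ ω, ENNReal.ofReal (circularDensity 1 (k - tailSum (gaussTail a b N ω) c)) *
      ENNReal.ofReal (‖tailSum (gaussTail a b N ω) d‖ ^ 2) ∂P with hq
  have hRc : Continuous R := by
    have := hφc A
    fun_prop
  -- both sides have the same integral over every measurable set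
  have hset : ∀ S : Set ℂ, MeasurableSet S →
      ∫⁻ k in S, q k = ∫⁻ k in S, ENNReal.ofReal (R k) := by
    intro S hS
    -- With `X = ∑ η_j c_j` and `V = ∑ η_j d_j`, the quantity `E[1_S(X) |V|²]` is computed twice:
    -- here by integrating out `η_0` and translating, and in `h2` by integrating out `X` after the
    -- regression split.
    have h1 : ∫⁻ ω, S.indicator 1 (gaussSum a b N c ω) *
        ENNReal.ofReal (‖tailSum (gaussTail a b N ω) d‖ ^ 2) ∂P = ∫⁻ k in S, q k := by
      have hSm : Measurable (S.indicator (1 : ℂ → ENNReal)) := measurable_one.indicator hS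
      simp_rw [hT]
      rw [lintegral_of_indepFun_of_hasLaw_withDensity (hφm 1) hab.hasLaw_gaussHead htail
        (hab.indepFun_gaussHead_gaussTail N) (F := fun w y => S.indicator 1 (w + tailSum y c) *
          ENNReal.ofReal (‖tailSum y d‖ ^ 2)) (by
          refine (hSm.comp (measurable_fst.add (hcm.comp measurable_snd))).mul ?_
          exact ((hdm.comp measurable_snd).norm.pow_const 2).ennreal_ofReal)]
      have hshift : ∀ ω, ∫⁻ w, ENNReal.ofReal (circularDensity 1 w) *
          (S.indicator 1 (w + tailSum (gaussTail a b N ω) c) *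
            ENNReal.ofReal (‖tailSum (gaussTail a b N ω) d‖ ^ 2)) =
          ∫⁻ k in S, ENNReal.ofReal (circularDensity 1 (k - tailSum (gaussTail a b N ω) c)) *
            ENNReal.ofReal (‖tailSum (gaussTail a b N ω) d‖ ^ 2) := by
        intro ω
        rw [← lintegral_indicator hS,
          ← lintegral_sub_right_eq_self _ (tailSum (gaussTail a b N ω) c)]
        refine lintegral_congr fun k => ?_
        simp only [sub_add_cancel]
        by_cases hk : k ∈ S <;> simp [hk]
      simp_rw [hshift]
      exact lintegral_lintegral_comp_swap htail (volume.restrict S) (F := fun k y =>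
        ENNReal.ofReal (circularDensity 1 (k - tailSum y c)) * ENNReal.ofReal (‖tailSum y d‖ ^ 2))
        (((hφm 1).comp (measurable_fst.sub (hcm.comp measurable_snd))).mul
          ((hdm.comp measurable_snd).norm.pow_const 2).ennreal_ofReal)
    have h2 : ∫⁻ ω, S.indicator 1 (gaussSum a b N c ω) *
        ENNReal.ofReal (‖tailSum (gaussTail a b N ω) d‖ ^ 2) ∂P =
        ∫⁻ k in S, ENNReal.ofReal (R k) := by
      have hSm : Measurable (S.indicator (1 : ℂ → ENNReal)) := measurable_one.indicator hS
      have hW := (hab.hasGaussianLaw_gaussSum N fun j => d j - γ * c j).aemeasurable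
      have hFm : Measurable (Function.uncurry fun k w : ℂ =>
          S.indicator 1 k * ENNReal.ofReal (‖γ * k + w‖ ^ 2)) :=
        (hSm.comp measurable_fst).mul
          (((measurable_fst.const_mul γ).add measurable_snd).norm.pow_const 2).ennreal_ofReal
      simp_rw [hV]
      rw [lintegral_of_indepFun_of_hasLaw_withDensity (hφm A) hlawT hW hind hFm,
        lintegral_lintegral_comp_swap hW volume (F := fun k w =>
          ENNReal.ofReal (circularDensity A k) *
            (S.indicator 1 k * ENNReal.ofReal (‖γ * k + w‖ ^ 2)))
          (((hφm A).comp measurable_fst).mul hFm), ← lintegral_indicator hS]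
      refine lintegral_congr fun k => ?_
      by_cases hk : k ∈ S
      · simp only [Set.indicator_of_mem hk, Pi.one_apply, one_mul]
        rw [lintegral_const_mul' _ _ ENNReal.ofReal_ne_top, hab.lintegral_norm_sq_add_gaussSum,
          ← ENNReal.ofReal_mul (circularDensity_nonneg hApos.le k), hres, norm_mul, mul_pow, hγn]
      · simp [hk]
    rw [← h1, h2]
  -- both sides are continuous
  have hVint : Integrable (fun ω => ‖tailSum (gaussTail a b N ω) d‖ ^ 2) P := by
    have := hab.integrable_norm_sq_gaussSum N d
    simpa only [gaussSum_eq_head_add_tail, hd, mul_zero, zero_add] using this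
  -- The Gaussian density is bounded by its value at the origin, which supplies the dominating
  -- function for continuity in the level.
  have hbound : ∀ w, ‖circularDensity 1 w‖ ≤ 1 / (2 * Real.pi * 1) := by
    intro w
    rw [Real.norm_of_nonneg (circularDensity_nonneg zero_le_one w), circularDensity]
    have := Real.pi_pos
    refine mul_le_of_le_one_right (by positivity) (Real.exp_le_one_iff.mpr ?_)
    have : 0 ≤ ‖w‖ ^ 2 / (2 * 1) := by positivity
    rw [neg_div]
    linarith
  have hmeas : ∀ k, AEStronglyMeasurable
      (fun ω => circularDensity 1 (k - tailSum (gaussTail a b N ω) c)) P := fun k =>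
    (((hφc 1).measurable.comp (measurable_const.sub hcm)).comp_aemeasurable
      htail).aestronglyMeasurable
  have hint : ∀ k, Integrable (fun ω => circularDensity 1 (k - tailSum (gaussTail a b N ω) c) *
      ‖tailSum (gaussTail a b N ω) d‖ ^ 2) P := fun k =>
    hVint.bdd_mul (hmeas k) (ae_of_all _ fun ω => hbound _)
  have hQc : Continuous fun k => ∫ ω, circularDensity 1 (k - tailSum (gaussTail a b N ω) c) *
      ‖tailSum (gaussTail a b N ω) d‖ ^ 2 ∂P := by
    refine continuous_of_dominated (fun k => (hint k).aestronglyMeasurable)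
      (bound := fun ω => 1 / (2 * Real.pi * 1) * ‖tailSum (gaussTail a b N ω) d‖ ^ 2)
      (fun k => ae_of_all _ fun ω => ?_) (hVint.const_mul _) (ae_of_all _ fun ω => ?_)
    · rw [norm_mul, norm_pow, norm_norm]
      exact mul_le_mul_of_nonneg_right (hbound _) (by positivity)
    · exact ((hφc 1).comp (continuous_id.sub continuous_const)).mul continuous_const
  have hqQ : q = fun k => ENNReal.ofReal (∫ ω, circularDensity 1
      (k - tailSum (gaussTail a b N ω) c) * ‖tailSum (gaussTail a b N ω) d‖ ^ 2 ∂P) := by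
    ext k
    rw [ofReal_integral_eq_lintegral_ofReal (hint k) (ae_of_all _ fun ω =>
      mul_nonneg (circularDensity_nonneg zero_le_one _) (by positivity))]
    exact lintegral_congr fun ω =>
      (ENNReal.ofReal_mul (circularDensity_nonneg zero_le_one _)).symm
  have hqc : Continuous q := hqQ ▸ ENNReal.continuous_ofReal.comp hQc
  have hRc' : Continuous fun k => ENNReal.ofReal (R k) := ENNReal.continuous_ofReal.comp hRc
  have hae : q =ᵐ[volume] fun k => ENNReal.ofReal (R k) :=
    ae_eq_of_forall_setLIntegral_eq_of_sigmaFinite hqc.measurable hRc'.measurable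
      fun S hS _ => hset S hS
  exact congrFun ((hqc.ae_eq_iff_eq volume hRc').mp hae) K

end

/-! ### The expected density of the zeros of a random power polynomial -/

/-- `∑_{j ≤ N} |z|^{2j}`. -/
def kernel₀ (N : ℕ) (z : ℂ) : ℝ := ∑ j ∈ Finset.range (N + 1), ‖z ^ j‖ ^ 2

/-- `∑_{j ≤ N} j z^{j-1} z̄^j`. -/
def kernel₁ (N : ℕ) (z : ℂ) : ℂ :=
  ∑ j ∈ Finset.range (N + 1), (j * z ^ (j - 1)) * starRingEnd ℂ (z ^ j)

/-- `∑_{j ≤ N} j² |z|^{2(j-1)}`. -/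
def kernel₂ (N : ℕ) (z : ℂ) : ℝ := ∑ j ∈ Finset.range (N + 1), ‖(j : ℂ) * z ^ (j - 1)‖ ^ 2

/-- The expected density of the zeros of `∑_{j ≤ N} η_j z^j = K`. -/
def zeroDensity (N : ℕ) (K z : ℂ) : ℝ :=
  circularDensity (kernel₀ N z) K * (‖kernel₁ N z‖ ^ 2 / kernel₀ N z ^ 2 * ‖K‖ ^ 2 +
    2 * (kernel₂ N z - ‖kernel₁ N z‖ ^ 2 / kernel₀ N z))

lemma kernel₀_pos (N : ℕ) (z : ℂ) : 0 < kernel₀ N z :=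
  Finset.sum_pos' (fun _ _ => by positivity) ⟨0, by simp, by simp⟩

/-- Cauchy–Schwarz; it makes the residual variance, and hence the density, nonnegative. -/
lemma norm_kernel₁_sq_le (N : ℕ) (z : ℂ) : ‖kernel₁ N z‖ ^ 2 ≤ kernel₂ N z * kernel₀ N z := by
  have h : ‖kernel₁ N z‖ ≤
      ∑ j ∈ Finset.range (N + 1), ‖(j : ℂ) * z ^ (j - 1)‖ * ‖z ^ j‖ := by
    refine (norm_sum_le _ _).trans (Finset.sum_le_sum fun j _ => ?_)
    rw [norm_mul (_ * _), RCLike.norm_conj]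
  exact (pow_le_pow_left₀ (norm_nonneg _) h 2).trans
    (Finset.sum_mul_sq_le_sq_mul_sq _ _ _)

lemma zeroDensity_nonneg (N : ℕ) (K z : ℂ) : 0 ≤ zeroDensity N K z := by
  have h0 := kernel₀_pos N z
  have h : ‖kernel₁ N z‖ ^ 2 / kernel₀ N z ≤ kernel₂ N z :=
    (div_le_iff₀ h0).mpr (norm_kernel₁_sq_le N z)
  have h' : 0 ≤ kernel₂ N z - ‖kernel₁ N z‖ ^ 2 / kernel₀ N z := sub_nonneg.mpr h
  exact mul_nonneg (circularDensity_nonneg h0.le K) (by positivity)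

lemma continuous_zeroDensity (N : ℕ) (K : ℂ) : Continuous (zeroDensity N K) := by
  have h0 : Continuous (kernel₀ N) := by unfold kernel₀; fun_prop
  have h1 : Continuous (kernel₁ N) := by
    unfold kernel₁
    have := Complex.continuous_conj
    fun_prop
  have h2 : Continuous (kernel₂ N) := by unfold kernel₂; fun_prop
  have hne : ∀ z, kernel₀ N z ≠ 0 := fun z => (kernel₀_pos N z).ne'
  unfold zeroDensity circularDensity
  refine Continuous.mul (Continuous.mul ?_ ?_) (Continuous.add (Continuous.mul ?_ ?_)
    (Continuous.mul continuous_const (Continuous.sub h2 ?_)))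
  · exact continuous_const.div (continuous_const.mul h0) fun z =>
      mul_ne_zero (by positivity) (hne z)
  · exact Real.continuous_exp.comp (continuous_const.div (continuous_const.mul h0) fun z =>
      mul_ne_zero two_ne_zero (hne z))
  · exact (h1.norm.pow 2).div (h0.pow 2) fun z => pow_ne_zero 2 (hne z)
  · exact continuous_const
  · exact (h1.norm.pow 2).div h0 hne

/-- The number of zeros in `Φ` of `w + ∑_{1 ≤ j ≤ N} y_j z^j - K`. -/
def tailZeroCount {N : ℕ} (K : ℂ) (Φ : Set ℂ) (w : ℂ) (y : Fin N → ℂ) : ENNReal :=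
  {z ∈ Φ | w + (tailSum y fun j => z ^ j) - K = 0}.encard

omit [MeasurableSpace Ω] in
lemma zeroCount_eq_tailZeroCount (a b : ℕ → Ω → ℝ) (N : ℕ) (K : ℂ) (Φ : Set ℂ) (ω : Ω) :
    (zeroCount a b (fun j z => z ^ j) N K Φ ω : ENNReal) =
      tailZeroCount K Φ (gaussHead a b ω) (gaussTail a b N ω) := by
  have : ∀ z, randomSum a b (fun j z => z ^ j) N ω z =
      gaussHead a b ω + tailSum (gaussTail a b N ω) fun j => z ^ j := by
    intro z
    refine (gaussSum_eq_head_add_tail a b N (fun j => z ^ j) ω).trans ?_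
    simp
  simp only [zeroCount, tailZeroCount, this, sub_eq_zero]

lemma measurable_tailZeroCount (N : ℕ) (K : ℂ) {Φ : Set ℂ} (hΦ : IsCompact Φ) :
    Measurable (Function.uncurry (tailZeroCount (N := N) K Φ)) := by
  refine measurable_encard_zeros (F := fun (p : ℂ × (Fin N → ℂ)) z =>
    p.1 + (tailSum p.2 fun j => z ^ j) - K) (fun z => ?_) (fun p => ?_) hΦ
  · have := measurable_tailSum (N := N) fun j => z ^ j
    fun_prop
  · unfold tailSum
    fun_prop

/-- Given the tail, the zeros form the fibre of `K - T` over the random point `η_0`. The area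
formula, Fubini and the regression identity with `c_j = z^j`, `d_j = j z^(j-1)` then give the
density. -/
lemma IsStdGaussianPair.isExpectedZeroDensity_zeroDensity {P : Measure Ω} {a b : ℕ → Ω → ℝ}
    (hab : IsStdGaussianPair P a b) (N : ℕ) (K : ℂ) :
    IsExpectedZeroDensity P a b (fun j z => z ^ j) N K (zeroDensity N K) := by
  have hP : IsProbabilityMeasure P := (hab.law_a 0).isProbabilityMeasure
  have htail := hab.aemeasurable_gaussTail N
  have hdiff : ∀ (y : Fin N → ℂ) (z : ℂ), HasDerivAt (fun z : ℂ => K - tailSum y fun j => z ^ j)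
      (-tailSum y fun j => j * z ^ (j - 1)) z := by
    intro y z
    have : HasDerivAt (fun z : ℂ => tailSum y fun j => z ^ j)
        (tailSum y fun j => j * z ^ (j - 1)) z := by
      unfold tailSum
      exact HasDerivAt.fun_sum fun j _ => (hasDerivAt_pow _ z).const_mul _
    exact this.const_sub K
  refine ⟨continuous_zeroDensity N K, zeroDensity_nonneg N K, fun Φ hΦ => ?_, fun Φ hΦ => ?_⟩
  · simp_rw [zeroCount_eq_tailZeroCount]
    have hpair : AEMeasurable (fun ω => (gaussHead a b ω, gaussTail a b N ω)) P :=
      hab.hasLaw_gaussHead.aemeasurable.prodMk htail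
    have := (measurable_tailZeroCount N K hΦ).comp_aemeasurable hpair
    exact this
  have hφm : Measurable fun w => ENNReal.ofReal (circularDensity 1 w) :=
    (continuous_circularDensity 1).measurable.ennreal_ofReal
  simp_rw [zeroCount_eq_tailZeroCount]
  rw [lintegral_of_indepFun_of_hasLaw_withDensity hφm hab.hasLaw_gaussHead htail
    (hab.indepFun_gaussHead_gaussTail N) (F := tailZeroCount K Φ)
    (measurable_tailZeroCount N K hΦ)]
  have hfiber : ∀ ω, ∫⁻ w, ENNReal.ofReal (circularDensity 1 w) *
      tailZeroCount K Φ w (gaussTail a b N ω) =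
      ∫⁻ z in Φ, ENNReal.ofReal (circularDensity 1
          (K - tailSum (gaussTail a b N ω) fun j => z ^ j)) *
        ENNReal.ofReal (‖tailSum (gaussTail a b N ω) fun j => j * z ^ (j - 1)‖ ^ 2) := by
    intro ω
    have h := lintegral_encard_fiber (G := fun z => K - tailSum (gaussTail a b N ω) fun j => z ^ j)
      (fun z => (hdiff _ z).differentiableAt) hΦ.measurableSet hφm
    simp_rw [(hdiff _ _).deriv, norm_neg] at h
    simp_rw [mul_comm (ENNReal.ofReal (‖_‖ ^ 2))] at h
    rw [← h]
    refine lintegral_congr fun w => ?_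
    rw [tailZeroCount]
    congr 3
    ext z
    simp only [Set.mem_ofPred_eq]
    rw [sub_eq_zero, eq_comm (a := _ + _), ← sub_eq_iff_eq_add]
  simp_rw [hfiber]
  have hjoint : ∀ c : ℕ → ℂ → ℂ, (∀ j, Continuous (c j)) →
      Measurable fun p : ℂ × (Fin N → ℂ) => tailSum p.2 fun j => c j p.1 := by
    intro c hc
    unfold tailSum
    exact Continuous.measurable (by fun_prop)
  rw [lintegral_lintegral_comp_swap htail (volume.restrict Φ) (F := fun z y =>
    ENNReal.ofReal (circularDensity 1 (K - tailSum y fun j => z ^ j)) *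
      ENNReal.ofReal (‖tailSum y fun j => j * z ^ (j - 1)‖ ^ 2))
    ((hφm.comp (measurable_const.sub (hjoint (fun j z => z ^ j) fun j => by fun_prop))).mul
      ((hjoint (fun j z => j * z ^ (j - 1)) fun j => by fun_prop).norm.pow_const 2).ennreal_ofReal)]
  refine lintegral_congr fun z => ?_
  exact hab.lintegral_density_mul_norm_sq N (c := fun j => z ^ j) (d := fun j => j * z ^ (j - 1))
    (pow_zero z) (by simp) rfl rfl rfl K

/-- A continuous expected density is determined by the expected counts. -/
lemma IsExpectedZeroDensity.unique {P : Measure Ω} {a b : ℕ → Ω → ℝ} {f : ℕ → ℂ → ℂ} {N : ℕ} {K : ℂ}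
    {g h : ℂ → ℝ} (hg : IsExpectedZeroDensity P a b f N K g)
    (hh : IsExpectedZeroDensity P a b f N K h) : g = h := by
  have hcont := hg.continuous.sub hh.continuous
  have hae : (fun z => g z - h z) =ᵐ[volume] 0 := by
    refine ae_eq_zero_of_forall_setIntegral_isCompact_eq_zero' hcont.locallyIntegrable
      fun s hs => ?_
    rw [integral_sub (hg.continuous.continuousOn.integrableOn_compact hs)
      (hh.continuous.continuousOn.integrableOn_compact hs),
      integral_eq_lintegral_of_nonneg_ae (ae_of_all _ hg.nonneg)
        hg.continuous.aestronglyMeasurable,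
      integral_eq_lintegral_of_nonneg_ae (ae_of_all _ hh.nonneg)
        hh.continuous.aestronglyMeasurable,
      ← hg.expectation_eq s hs, ← hh.expectation_eq s hs, sub_self]
  have := (hcont.ae_eq_iff_eq volume continuous_zero).mp hae
  ext z
  exact sub_eq_zero.mp (congrFun this z)

/-! ### The limit inside the unit disc -/

lemma tendsto_kernel₀ {z : ℂ} (hz : ‖z‖ < 1) :
    Tendsto (fun N => kernel₀ N z) atTop (𝓝 (B z)) := by
  have hr : ‖z‖ ^ 2 < 1 := pow_lt_one₀ (norm_nonneg z) hz two_ne_zero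
  have h := (hasSum_geometric_of_lt_one (sq_nonneg ‖z‖) hr).tendsto_sum_nat.comp
    (tendsto_add_atTop_nat 1)
  rw [B, one_div]
  refine h.congr fun N => Finset.sum_congr rfl fun j _ => ?_
  rw [norm_pow, ← pow_mul, ← pow_mul, mul_comm]

lemma tendsto_norm_kernel₁_sq {z : ℂ} (hz : ‖z‖ < 1) :
    Tendsto (fun N => ‖kernel₁ N z‖ ^ 2) atTop (𝓝 (‖z‖ ^ 2 * B z ^ 4)) := by
  have hr : ‖(‖z‖ ^ 2 : ℝ)‖ < 1 := by
    rw [norm_pow, norm_norm]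
    exact pow_lt_one₀ (norm_nonneg z) hz two_ne_zero
  have h := ((hasSum_choose_mul_geometric_of_norm_lt_one 1 hr).tendsto_sum_nat.pow 2).const_mul
    (‖z‖ ^ 2)
  have hval : (1 / (1 - ‖z‖ ^ 2) ^ (1 + 1)) ^ 2 = B z ^ 4 := by
    simp only [B, one_div, inv_pow, ← pow_mul]
  rw [hval] at h
  refine h.congr fun N => ?_
  -- The `j = 0` term vanishes through its factor `j`, so truncated subtraction in the exponent is
  -- harmless. Shifting the index leaves `z̄ ∑ (j+1) |z|^(2j)`.
  have : kernel₁ N z = starRingEnd ℂ z *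
      ((∑ j ∈ Finset.range N, ((j + 1).choose 1 : ℝ) * (‖z‖ ^ 2) ^ j : ℝ) : ℂ) := by
    rw [kernel₁, Finset.sum_range_succ', Complex.ofReal_sum, Finset.mul_sum]
    simp only [Nat.cast_zero, zero_mul, add_zero, Nat.add_sub_cancel, Nat.choose_one_right]
    refine Finset.sum_congr rfl fun j _ => ?_
    push_cast
    rw [← Complex.mul_conj', map_pow, mul_pow, pow_succ]
    ring
  rw [this, norm_mul, RCLike.norm_conj, mul_pow, Complex.norm_real, Real.norm_eq_abs, sq_abs]

lemma tendsto_kernel₂ {z : ℂ} (hz : ‖z‖ < 1) :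
    Tendsto (fun N => kernel₂ N z) atTop (𝓝 ((1 + ‖z‖ ^ 2) * B z ^ 3)) := by
  have hr' : ‖z‖ ^ 2 < 1 := pow_lt_one₀ (norm_nonneg z) hz two_ne_zero
  have hr : ‖(‖z‖ ^ 2 : ℝ)‖ < 1 := by rwa [norm_pow, norm_norm]
  -- After the index shift the coefficients are `(j+1)² = 2 C(j+2, 2) - (j+1)`, a combination of two
  -- negative binomial series.
  have h := ((hasSum_choose_mul_geometric_of_norm_lt_one 2 hr).tendsto_sum_nat.const_mul 2).sub
    (hasSum_choose_mul_geometric_of_norm_lt_one 1 hr).tendsto_sum_nat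
  have hval : 2 * (1 / (1 - ‖z‖ ^ 2) ^ (2 + 1)) - 1 / (1 - ‖z‖ ^ 2) ^ (1 + 1) =
      (1 + ‖z‖ ^ 2) * B z ^ 3 := by
    have : 1 - ‖z‖ ^ 2 ≠ 0 := by linarith
    rw [B]
    field_simp
    ring
  rw [hval] at h
  refine h.congr fun N => ?_
  rw [kernel₂, Finset.sum_range_succ', Finset.mul_sum, ← Finset.sum_sub_distrib]
  simp only [Nat.cast_zero, zero_mul, norm_zero, ne_eq, OfNat.ofNat_ne_zero, not_false_eq_true,
    zero_pow, add_zero, Nat.add_sub_cancel, Nat.choose_one_right]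
  refine Finset.sum_congr rfl fun j _ => ?_
  rw [Nat.cast_choose_two, norm_mul, norm_pow, Complex.norm_natCast, ← pow_mul]
  push_cast
  ring

/-- The residual variance tends to `(1 + |z|²) B³ - |z|² B³ = B³`, and `|γ|²` tends to `|z|² B²`.
Multiplying by the prefactor `1/(2πB)` gives the stated shape. -/
lemma tendsto_zeroDensity (K : ℂ) {z : ℂ} (hz : ‖z‖ < 1) :
    Tendsto (fun N => zeroDensity N K z) atTop
      (𝓝 (1 / Real.pi * Real.exp (-(K.re ^ 2 + K.im ^ 2) / (2 * B z)) *
        B z * (B z + (K.re ^ 2 + K.im ^ 2) / 2 * ‖z‖ ^ 2))) := by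
  have hr : ‖z‖ ^ 2 < 1 := pow_lt_one₀ (norm_nonneg z) hz two_ne_zero
  have hB : 0 < B z := one_div_pos.mpr (by linarith)
  have hπ := Real.pi_pos
  have h0 := tendsto_kernel₀ hz
  have h1 := tendsto_norm_kernel₁_sq hz
  have h2 := tendsto_kernel₂ hz
  have hK : K.re ^ 2 + K.im ^ 2 = ‖K‖ ^ 2 := by
    rw [← Complex.normSq_eq_norm_sq, Complex.normSq_apply]
    ring
  have hlim := ((tendsto_const_nhds (x := (1 : ℝ))).div (h0.const_mul (2 * Real.pi))
    (by positivity)).mul ((Real.continuous_exp.tendsto _).comp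
      ((tendsto_const_nhds (x := -‖K‖ ^ 2)).div (h0.const_mul 2) (by positivity)))
  have hlim' := hlim.mul (((h1.div (h0.pow 2) (by positivity)).mul_const (‖K‖ ^ 2)).add
    ((h2.sub (h1.div h0 hB.ne')).const_mul 2))
  rw [hK]
  refine (hlim'.congr fun N => rfl).trans (le_of_eq ?_)
  congr 1
  generalize Real.exp _ = E
  field_simp
  ring

end RandomSum
end

/-! ### The theorem and its special levels -/

theorem theorem4 {Ω : Type*} [MeasurableSpace Ω] (P : Measure Ω) [IsProbabilityMeasure P]
    (a b : ℕ → Ω → ℝ) (hab : RandomSum.IsStdGaussianPair P a b) :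
    ∃ h : ℕ → ℂ → ℂ → ℝ,
      -- `h N K` is the expected density of the zeros of `∑_{j ≤ N} η_j z^j = K`
      (∀ N : ℕ, 0 < N → ∀ K : ℂ,
        RandomSum.IsExpectedZeroDensity P a b (fun j z => z ^ j) N K (h N K) ∧
        ∀ g : ℂ → ℝ, RandomSum.IsExpectedZeroDensity P a b (fun j z => z ^ j) N K g →
          g = h N K) ∧
      -- the limit for an arbitrary level `K = K₁ + i K₂`
      (∀ K z : ℂ, ‖z‖ < 1 →
        Tendsto (fun N => h N K z) atTop
          (𝓝 (1 / Real.pi * Real.exp (-(K.re ^ 2 + K.im ^ 2) / (2 * RandomSum.B z)) *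
            RandomSum.B z * (RandomSum.B z + (K.re ^ 2 + K.im ^ 2) / 2 * ‖z‖ ^ 2)))) ∧
      -- levels on the circle `K₁² + K₂² = 2 R²`, which contains `(R, R)`
      (∀ R : ℝ, 0 < R → ∀ K : ℂ, K.re ^ 2 + K.im ^ 2 = 2 * R ^ 2 → ∀ z : ℂ, ‖z‖ < 1 →
        Tendsto (fun N => h N K z) atTop
          (𝓝 (1 / Real.pi * Real.exp (-R ^ 2 / RandomSum.B z) *
            RandomSum.B z * (RandomSum.B z + R ^ 2 * ‖z‖ ^ 2)))) ∧
      -- levels on the circle `|K| = R`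
      (∀ R : ℝ, 0 < R → ∀ K : ℂ, ‖K‖ = R → ∀ z : ℂ, ‖z‖ < 1 →
        Tendsto (fun N => h N K z) atTop
          (𝓝 (1 / Real.pi * Real.exp (-R ^ 2 / (2 * RandomSum.B z)) *
            RandomSum.B z * (RandomSum.B z + R ^ 2 / 2 * ‖z‖ ^ 2)))) ∧
      -- the level `K = 0`
      (∀ z : ℂ, ‖z‖ < 1 →
        Tendsto (fun N => h N 0 z) atTop (𝓝 (1 / Real.pi * RandomSum.B z ^ 2))) := by
  refine ⟨RandomSum.zeroDensity, fun N _ K => ?_, fun K z hz => RandomSum.tendsto_zeroDensity K hz,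
    fun R _ K hK z hz => ?_, fun R _ K hK z hz => ?_, fun z hz => ?_⟩
  · have h := hab.isExpectedZeroDensity_zeroDensity N K
    exact ⟨h, fun g hg => hg.unique h⟩
  · convert RandomSum.tendsto_zeroDensity K hz using 2
    rw [hK, neg_mul_eq_mul_neg, mul_div_mul_left _ _ two_ne_zero, mul_div_cancel_left₀ _ two_ne_zero]
  · have hK' : K.re ^ 2 + K.im ^ 2 = R ^ 2 := by
      rw [← hK, ← Complex.normSq_eq_norm_sq, Complex.normSq_apply]
      ring
    simpa only [hK'] using RandomSum.tendsto_zeroDensity K hz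
  · convert RandomSum.tendsto_zeroDensity 0 hz using 2
    simp
    ring
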